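/- Let $\mathcal Y$ be a finite nonempty set, $d\ge 1$, and $\phi:\mathcal Y\to\{0,1\}^d$. For $\theta\in\mathbb R^d$ let $p_\theta(y)=\exp\{\phi(y)^\top\theta-A(\theta)\}$ with $A(\theta)=\log\sum_{y\in\mathcal Y}\exp\{\phi(y)^\top\theta\}$. Fix $\theta^*\in\mathbb R^d$ and assume that the Fisher information matrix $\mathcal I=\operatorname{Cov}_{y\sim p_{\theta^*}}[\phi(y)]$ is invertible. Let $\alpha>0$ and $q_\alpha=e^{\alpha/2}/(1+e^{\alpha/2})$. The coordinate release mechanism with uniform coordinate sampling takes $y$, draws $j\in\{1,\dots,d\}$ uniformly, sets $b=\phi(y)[j]$ with probability $q_\alpha$ and $b=1-\phi(y)[j]$ otherwise, and releases $o=(j,b)$; let $S(o\mid y)$ be its conditional distribution. Let $\beta(j,b)=d\,\frac{b-1+q_\alpha}{2q_\alpha-1}\,e_j$, where $e_j$ is the $j$-th standard basis vector. Let $(y^{(i)},o^{(i)})_{i\ge1}$ be i.i.d. with $y^{(i)}\sim p_{\theta^*}$ and $o^{(i)}\mid y^{(i)}\sim S(\cdot\mid y^{(i)})$, let $\hat\mu_n=\frac1n\sum_{i=1}^n\beta(o^{(i)})$,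 and let the moment-based estimator $\hat\theta_n$ be a (measurable) element of $\arg\max_\theta\{\hat\mu_n^\top\theta-A(\theta)\}$ whenever this set is nonempty (with an arbitrary value otherwise). **Theorem (Asymptotic variance, coordinate release).** The mechanism is $\alpha$-differentially private, i.e. $S(o\mid y)\le e^{\alpha}S(o\mid y')$ for all $o,y,y'$, and the moment-based estimator has asymptotic variance $\mathcal I^{-1}+\mathcal I^{-1}H\mathcal I^{-1}$, i.e. $$\sqrt n\,(\hat\theta_n-\theta^*)\ \xrightarrow{d}\ \mathcal N\bigl(0,\ \mathcal I^{-1}+\mathcal I^{-1}H\mathcal I^{-1}\bigr),$$ where, with $I_d$ the $d\times d$ identity matrix, $$H=\frac{d\,q_\alpha(1-q_\alpha)}{(2q_\alpha-1)^2}\,I_d+\mathbb E_{y\sim p_{\theta^*}}\bigl[d\,\operatorname{diag}(\phi(y))^2-\phi(y)\phi(y)^\top\bigr].$$ -/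

import Mathlib

open MeasureTheory ProbabilityTheory Filter Topology Matrix
open scoped ENNReal

noncomputable section

namespace IndirectSupervision

/-! ### Exponential family over a finite label set -/

section Model

variable {Y : Type*} [Fintype Y] {d : ℕ}

/-- Log-partition function `A(θ) = log ∑_y exp (φ(y)ᵀ θ)`. -/
def logPartition (φ : Y → EuclideanSpace ℝ (Fin d)) (θ : EuclideanSpace ℝ (Fin d)) : ℝ :=
  Real.log (∑ y, Real.exp (inner ℝ (φ y) θ))

/-- The model density `p_θ(y) = exp (φ(y)ᵀ θ - A(θ))`. -/
def modelDensity (φ : Y → EuclideanSpace ℝ (Fin d)) (θ : EuclideanSpace ℝ (Fin d)) (y : Y) : ℝ :=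
  Real.exp (inner ℝ (φ y) θ - logPartition φ θ)

theorem sum_modelDensity [Nonempty Y] (φ : Y → EuclideanSpace ℝ (Fin d))
    (θ : EuclideanSpace ℝ (Fin d)) : ∑ y, modelDensity φ θ y = 1 := by
  have h : 0 < ∑ y, Real.exp (inner ℝ (φ y) θ) :=
    Finset.sum_pos (fun y _ => Real.exp_pos _) Finset.univ_nonempty
  simp only [modelDensity, logPartition, Real.exp_sub, Real.exp_log h]
  rw [← Finset.sum_div, div_self h.ne']

/-- The model `p_θ` as a probability distribution on `Y`. -/
def model [Nonempty Y] (φ : Y → EuclideanSpace ℝ (Fin d)) (θ : EuclideanSpace ℝ (Fin d)) : PMF Y :=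
  PMF.ofFintype (fun y => ENNReal.ofReal (modelDensity φ θ y)) (by
    have h0 : ∀ y ∈ Finset.univ, 0 ≤ modelDensity φ θ y := fun y _ => (Real.exp_pos _).le
    rw [← ENNReal.ofReal_sum_of_nonneg h0, sum_modelDensity, ENNReal.ofReal_one])

/-- Fisher information `Cov[φ(y)]` for `y ∼ p_θ`. -/
def fisherInformation [Nonempty Y] [MeasurableSpace Y] (φ : Y → EuclideanSpace ℝ (Fin d))
    (θ : EuclideanSpace ℝ (Fin d)) : Matrix (Fin d) (Fin d) ℝ :=
  Matrix.of fun i j => cov[fun y => φ y i, fun y => φ y j; (model φ θ).toMeasure]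

end Model

/-! ### The coordinate release mechanism -/

/-- The distribution of a Boolean equal to `true` with probability `p`
(`p` is truncated to `[0, 1]`). -/
def bern (p : ℝ) : PMF Bool :=
  PMF.ofFintype (fun b => bif b then min (ENNReal.ofReal p) 1 else 1 - min (ENNReal.ofReal p) 1)
    (by simp)

/-- `q_t = e^{t/2} / (1 + e^{t/2})`. -/
def keepProb (t : ℝ) : ℝ := Real.exp (t / 2) / (1 + Real.exp (t / 2))

/-- Binarization of a vector `v` with coordinates in `[0, c]`: independent bits, the `i`-th one
being `1` with probability `v i / c`. -/
def binarize {d : ℕ} (c : ℝ) (v : EuclideanSpace ℝ (Fin d)) : PMF (Fin d → Bool) :=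
  PMF.ofFintype (fun t => ∏ i, bern (v i / c) (t i)) (by
    rw [← Fintype.piFinset_univ, ← Finset.prod_univ_sum]
    refine Finset.prod_eq_one fun i _ => ?_
    rw [← tsum_fintype (L := .unconditional _)]
    exact (bern (v i / c)).tsum_coe)

/-- Coordinate release of a vector `v` with coordinates in `[0, c]`: binarize `v` to `t`, draw a
coordinate `j ∼ p`, keep the bit `t j` with probability `q_α` and flip it otherwise, and release `j`
with the resulting bit. -/
def coordinateRelease {d : ℕ} (p : PMF (Fin d)) (α c : ℝ) (v : EuclideanSpace ℝ (Fin d)) :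
    PMF (Fin d × Bool) :=
  (binarize c v).bind fun t => p.bind fun j =>
    (bern (keepProb α)).map fun keep => (j, if keep then t j else !(t j))

/-- The observation function
`β(j, o) = p(j)⁻¹ * (o - 1 + q_α) / (2 q_α - 1) * c * e_j`. -/
def coordinateReleaseObs {d : ℕ} (p : PMF (Fin d)) (α c : ℝ) (o : Fin d × Bool) :
    EuclideanSpace ℝ (Fin d) :=
  ((p o.1).toReal⁻¹ * (((if o.2 then 1 else 0) - 1 + keepProb α) / (2 * keepProb α - 1)) * c) •
    EuclideanSpace.single o.1 (1 : ℝ)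

/-- `S` is `α`-differentially private: `S(o ∣ y) ≤ e^α S(o ∣ y')` for all `o, y, y'`. -/
def IsDifferentiallyPrivate {Y O : Type*} (S : Y → PMF O) (α : ℝ) : Prop :=
  ∀ (o : O) (y y' : Y), S y o ≤ ENNReal.ofReal (Real.exp α) * S y' o

/-! ### Moment-based estimation -/

/-- The joint distribution of `(y, o)` when `y ∼ π` and `o ∼ S(· ∣ y)`. -/
def jointLaw {Y O : Type*} (π : PMF Y) (S : Y → PMF O) : PMF (Y × O) :=
  π.bind fun y => (S y).map fun o => (y, o)

/-- The empirical mean `μ̂` of the observation function over the first `n` observations. -/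
def empiricalMoment {O : Type*} {d : ℕ} (β : O → EuclideanSpace ℝ (Fin d)) (n : ℕ) (o : ℕ → O) :
    EuclideanSpace ℝ (Fin d) :=
  (n : ℝ)⁻¹ • ∑ i ∈ Finset.range n, β (o i)

/-- `θhat ∈ argmax_θ {μhatᵀ θ - A(θ)}` whenever this set is nonempty; the value of the estimator is
unrestricted for those `μhat` for which no maximizer exists. -/
def IsMomentEstimate {Y : Type*} [Fintype Y] {d : ℕ} (φ : Y → EuclideanSpace ℝ (Fin d))
    (μhat θhat : EuclideanSpace ℝ (Fin d)) : Prop :=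
  (∃ θ, IsMaxOn (fun θ' => inner ℝ μhat θ' - logPartition φ θ') Set.univ θ) →
    IsMaxOn (fun θ' => inner ℝ μhat θ' - logPartition φ θ') Set.univ θhat

/-- The estimators `θhat n` of `θ` have asymptotic variance `V`:
`√n (θhat n - θ)` converges in distribution to `N(0, V)`. -/
def HasAsymptoticVariance {Ω : Type*} [MeasurableSpace Ω] (P : Measure Ω) [IsProbabilityMeasure P]
    {d : ℕ} (θhat : ℕ → Ω → EuclideanSpace ℝ (Fin d)) (θ : EuclideanSpace ℝ (Fin d))
    (V : Matrix (Fin d) (Fin d) ℝ) : Prop :=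
  V.PosSemidef ∧
    TendstoInDistribution (fun (n : ℕ) ω => √(n : ℝ) • (θhat n ω - θ)) atTop
      (id : EuclideanSpace ℝ (Fin d) → EuclideanSpace ℝ (Fin d)) (fun _ => P)
      (multivariateGaussian 0 V)

/-- `H = d q_α (1 - q_α) / (2 q_α - 1)² I + E[d diag(φ(y))² - φ(y) φ(y)ᵀ]`, `y ∼ π`,
with the expectation taken entrywise. -/
def coordinateReleaseLoss {Y : Type*} [MeasurableSpace Y] {d : ℕ}
    (φ : Y → EuclideanSpace ℝ (Fin d)) (π : PMF Y) (α : ℝ) : Matrix (Fin d) (Fin d) ℝ :=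
  ((d : ℝ) * keepProb α * (1 - keepProb α) / (2 * keepProb α - 1) ^ 2) •
      (1 : Matrix (Fin d) (Fin d) ℝ) +
    Matrix.of fun i j => ∫ y, ((d : ℝ) • (Matrix.diagonal fun k => φ y k) ^ 2 -
      Matrix.vecMulVec (fun k => φ y k) (fun k => φ y k)) i j ∂π.toMeasure

end IndirectSupervision

end

/-! Privacy holds because a released bit has likelihood `q` or `1 - q`, and `q / (1 - q) = e^{α/2}`.

For the limit law, put `J` for the Fisher information. Debiasing makes `E[β(o) | y] = φ(y)`, so the
observations `β(o i)` are i.i.d. with mean `E[φ(y)]`. By the law of total variance their covariance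
is `J + H`: `J` is the covariance of the conditional mean and `H` is the mean of the conditional
covariance (`variance_jointLaw_coordinateReleaseObs`). The central limit theorem gives `√n (μ̂ -
E[φ(y)]) → N(0, J + H)`.

The gradient of `A` is the mean map, whose derivative at `θ*` is the invertible `J`. Near the true
mean the moment estimate is therefore the local inverse of the mean map
(`exists_hasFDerivAt_momentEstimate`), with derivative `J⁻¹`. By the strong law `μ̂` almost surely
ends up in that neighbourhood, so the delta method yields covariance `J⁻¹ (J + H) J⁻¹ = J⁻¹ + J⁻¹ H
J⁻¹`. -/

namespace IndirectSupervision

/-! ### The mechanism: privacy and conditional moments. -/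

section Mechanism

variable {d : ℕ}

theorem keepProb_pos (t : ℝ) : 0 < keepProb t := by
  unfold keepProb; positivity

theorem keepProb_lt_one (t : ℝ) : keepProb t < 1 := by
  unfold keepProb
  rw [div_lt_one (by positivity)]
  linarith

theorem keepProb_eq_exp_mul (t : ℝ) : keepProb t = Real.exp (t / 2) * (1 - keepProb t) := by
  unfold keepProb
  field_simp
  ring

theorem half_lt_keepProb {t : ℝ} (ht : 0 < t) : 1 / 2 < keepProb t := by
  have h : 1 < Real.exp (t / 2) := Real.one_lt_exp_iff.2 (by linarith)
  unfold keepProb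
  rw [div_lt_div_iff₀ (by norm_num) (by positivity)]
  linarith

theorem bern_apply {p : ℝ} (h0 : 0 ≤ p) (h1 : p ≤ 1) (b : Bool) :
    bern p b = ENNReal.ofReal (if b then p else 1 - p) := by
  have h : min (ENNReal.ofReal p) 1 = ENNReal.ofReal p :=
    min_eq_left (by simpa using h1)
  cases b
  · simp [bern, h, ENNReal.ofReal_sub _ h0]
  · simp [bern, h]

theorem bern_one : bern 1 = PMF.pure true := by
  ext b; cases b <;> simp [bern]

theorem bern_zero : bern 0 = PMF.pure false := by
  ext b; cases b <;> simp [bern]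

theorem binarize_of_binary {v : EuclideanSpace ℝ (Fin d)} (hv : ∀ i, v i = 0 ∨ v i = 1) :
    binarize 1 v = PMF.pure fun i => decide (v i = 1) := by
  have h (i : Fin d) : bern (v i / 1) = PMF.pure (decide (v i = 1)) := by
    rcases hv i with h | h <;> simp [h, bern_one, bern_zero]
  ext t
  simp only [binarize, PMF.ofFintype_apply, h, PMF.pure_apply]
  by_cases ht : t = fun i => decide (v i = 1)
  · simp [ht]
  · rw [if_neg ht]
    obtain ⟨i, hi⟩ := Function.ne_iff.1 ht
    exact Finset.prod_eq_zero (Finset.mem_univ i) (if_neg hi)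

theorem coordinateRelease_apply (p : PMF (Fin d)) (α : ℝ) {v : EuclideanSpace ℝ (Fin d)}
    (hv : ∀ i, v i = 0 ∨ v i = 1) (j : Fin d) (b : Bool) :
    coordinateRelease p α 1 v (j, b) =
      p j * ENNReal.ofReal (if b = decide (v j = 1) then keepProb α else 1 - keepProb α) := by
  rw [coordinateRelease, binarize_of_binary hv, PMF.pure_bind, PMF.bind_apply, tsum_fintype,
    Finset.sum_eq_single j]
  · congr 1
    rw [PMF.map_apply, tsum_fintype]
    simp only [Fintype.sum_bool, bern_apply (keepProb_pos α).le (keepProb_lt_one α).le]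
    cases b <;> cases decide (v j = 1) <;> simp
  · intro k _ hk
    rw [PMF.map_apply, tsum_fintype]
    simp [hk.symm]
  · simp

/-- The factor `p j` is common to both sides, and the bit likelihoods differ by a factor of at most
`e^{α/2}`, which is even below `e^α`. -/
theorem isDifferentiallyPrivate_coordinateRelease {Y : Type*} (p : PMF (Fin d))
    {φ : Y → EuclideanSpace ℝ (Fin d)} (hφ : ∀ y i, φ y i = 0 ∨ φ y i = 1) {α : ℝ} (hα : 0 < α) :
    IsDifferentiallyPrivate (fun y => coordinateRelease p α 1 (φ y)) α := by
  rintro ⟨j, b⟩ y y'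
  simp only [coordinateRelease_apply p α (hφ _)]
  rw [mul_left_comm, ← ENNReal.ofReal_mul (Real.exp_pos α).le]
  refine mul_le_mul_right (ENNReal.ofReal_le_ofReal ?_) _
  have h1 := half_lt_keepProb hα
  have h2 := keepProb_lt_one α
  have h3 := keepProb_eq_exp_mul α
  have h4 : Real.exp (α / 2) ≤ Real.exp α := Real.exp_le_exp.2 (by linarith)
  have h5 : 1 < Real.exp α := Real.one_lt_exp_iff.2 hα
  split_ifs <;> nlinarith

/-- The unbiased estimate of the coordinate bit given the released bit `b`. -/
noncomputable def debias (α : ℝ) (b : Bool) : ℝ :=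
  ((if b then 1 else 0) - 1 + keepProb α) / (2 * keepProb α - 1)

theorem integral_coordinateRelease [NeZero d] (α : ℝ) {v : EuclideanSpace ℝ (Fin d)}
    (hv : ∀ i, v i = 0 ∨ v i = 1) (f : Fin d × Bool → ℝ) :
    ∫ o, f o ∂(coordinateRelease (PMF.uniformOfFintype (Fin d)) α 1 v).toMeasure =
      ∑ j, (d : ℝ)⁻¹ * (keepProb α * f (j, decide (v j = 1)) +
        (1 - keepProb α) * f (j, !decide (v j = 1))) := by
  have h1 : 0 ≤ 1 - keepProb α := by linarith [keepProb_lt_one α]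
  rw [PMF.integral_eq_sum, Fintype.sum_prod_type]
  refine Finset.sum_congr rfl fun j _ => ?_
  simp only [coordinateRelease_apply _ α hv, PMF.uniformOfFintype_apply, Fintype.sum_bool]
  cases decide (v j = 1) <;>
    simp [ENNReal.toReal_ofReal, (keepProb_pos α).le, h1] <;> ring

theorem integral_jointLaw {Y O : Type*} [Fintype Y] [MeasurableSpace Y] [DiscreteMeasurableSpace Y]
    [Fintype O] [MeasurableSpace O] [DiscreteMeasurableSpace O] (π : PMF Y) (S : Y → PMF O)
    (f : O → ℝ) :
    ∫ x, f x.2 ∂(jointLaw π S).toMeasure = ∑ y, (π y).toReal * ∫ o, f o ∂(S y).toMeasure := by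
  classical
  have h (y : Y) (o : O) : jointLaw π S (y, o) = π y * S y o := by
    rw [jointLaw, PMF.bind_apply, tsum_fintype, Finset.sum_eq_single y]
    · rw [PMF.map_apply, tsum_fintype]
      simp
    · intro k _ hk
      rw [PMF.map_apply, tsum_fintype]
      simp [hk.symm]
    · simp
  simp only [PMF.integral_eq_sum, Fintype.sum_prod_type, h, ENNReal.toReal_mul, smul_eq_mul,
    Finset.mul_sum, mul_assoc]

theorem inner_coordinateReleaseObs [NeZero d] (α : ℝ) (u : EuclideanSpace ℝ (Fin d))
    (o : Fin d × Bool) :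
    inner ℝ u (coordinateReleaseObs (PMF.uniformOfFintype (Fin d)) α 1 o) =
      d * debias α o.2 * u o.1 := by
  simp [coordinateReleaseObs, inner_smul_right, EuclideanSpace.inner_single_right, debias]

theorem integral_inner_coordinateReleaseObs [NeZero d] {α : ℝ} (hα : 0 < α)
    {v : EuclideanSpace ℝ (Fin d)} (hv : ∀ i, v i = 0 ∨ v i = 1)
    (u : EuclideanSpace ℝ (Fin d)) :
    ∫ o, inner ℝ u (coordinateReleaseObs (PMF.uniformOfFintype (Fin d)) α 1 o)
      ∂(coordinateRelease (PMF.uniformOfFintype (Fin d)) α 1 v).toMeasure = inner ℝ u v := by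
  have h1 : 2 * keepProb α - 1 ≠ 0 := by linarith [half_lt_keepProb hα]
  have hd : (d : ℝ) ≠ 0 := NeZero.ne _
  simp only [inner_coordinateReleaseObs]
  rw [integral_coordinateRelease α hv fun o => d * debias α o.2 * u o.1, PiLp.inner_apply]
  refine Finset.sum_congr rfl fun j _ => ?_
  have h0 : keepProb α * 2 - 1 ≠ 0 := by rwa [mul_comm]
  -- Unbiasedness of the debiased bit, for a true bit equal to 1 and then to 0.
  have h2 : keepProb α * debias α true + (1 - keepProb α) * debias α false = 1 := by
    simp [debias]; field_simp; ring
  have h3 : keepProb α * debias α false + (1 - keepProb α) * debias α true = 0 := by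
    simp [debias]; field_simp; ring
  have h4 (b c : ℝ) : (d : ℝ)⁻¹ * (keepProb α * (d * b * u j) + (1 - keepProb α) * (d * c * u j)) =
      (keepProb α * b + (1 - keepProb α) * c) * u j := by field_simp
  rw [h4]
  rcases hv j with h | h <;> simp [h, h2, h3]

/-- Each release has a single nonzero coordinate, so no cross terms appear, and `d² · d⁻¹` leaves
the factor `d`. The debiased bit has variance `q (1 - q) / (2 q - 1)²` around the true bit. -/
theorem integral_sq_inner_coordinateReleaseObs [NeZero d] {α : ℝ} (hα : 0 < α)
    {v : EuclideanSpace ℝ (Fin d)} (hv : ∀ i, v i = 0 ∨ v i = 1)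
    (u : EuclideanSpace ℝ (Fin d)) :
    ∫ o, inner ℝ u (coordinateReleaseObs (PMF.uniformOfFintype (Fin d)) α 1 o) ^ 2
      ∂(coordinateRelease (PMF.uniformOfFintype (Fin d)) α 1 v).toMeasure =
      ∑ j, d * (v j ^ 2 + keepProb α * (1 - keepProb α) / (2 * keepProb α - 1) ^ 2) * u j ^ 2 := by
  have h1 : 2 * keepProb α - 1 ≠ 0 := by linarith [half_lt_keepProb hα]
  have hd : (d : ℝ) ≠ 0 := NeZero.ne _
  simp only [inner_coordinateReleaseObs,
    integral_coordinateRelease α hv (fun o => (d * debias α o.2 * u o.1) ^ 2)]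
  refine Finset.sum_congr rfl fun j _ => ?_
  have h2 : keepProb α * 2 - 1 ≠ 0 := by rwa [mul_comm]
  rcases hv j with h | h <;> simp [h, debias] <;> field_simp <;> ring

end Mechanism

/-! ### The exponential family: mean map and moment objective. -/

section ExponentialFamily

variable {Y : Type*} [Fintype Y] {d : ℕ}

theorem modelDensity_pos (φ : Y → EuclideanSpace ℝ (Fin d)) (θ : EuclideanSpace ℝ (Fin d)) (y : Y) :
    0 < modelDensity φ θ y := Real.exp_pos _

/-- The mean `E[φ(y)]` for `y ∼ p_θ`. -/
noncomputable def meanParam (φ : Y → EuclideanSpace ℝ (Fin d)) (θ : EuclideanSpace ℝ (Fin d)) :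
    EuclideanSpace ℝ (Fin d) :=
  ∑ y, modelDensity φ θ y • φ y

theorem inner_meanParam (φ : Y → EuclideanSpace ℝ (Fin d)) (θ u : EuclideanSpace ℝ (Fin d)) :
    inner ℝ u (meanParam φ θ) = ∑ y, modelDensity φ θ y * inner ℝ u (φ y) := by
  simp [meanParam, inner_sum, inner_smul_right]

variable [Nonempty Y]

theorem sum_exp_pos (φ : Y → EuclideanSpace ℝ (Fin d)) (θ : EuclideanSpace ℝ (Fin d)) :
    0 < ∑ y, Real.exp (inner ℝ (φ y) θ) :=
  Finset.sum_pos (fun _ _ => Real.exp_pos _) Finset.univ_nonempty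

theorem toReal_model (φ : Y → EuclideanSpace ℝ (Fin d)) (θ : EuclideanSpace ℝ (Fin d)) (y : Y) :
    (model φ θ y).toReal = modelDensity φ θ y := by
  simp [model, ENNReal.toReal_ofReal (modelDensity_pos φ θ y).le]

theorem hasStrictFDerivAt_logPartition (φ : Y → EuclideanSpace ℝ (Fin d))
    (θ : EuclideanSpace ℝ (Fin d)) :
    HasStrictFDerivAt (logPartition φ) (innerSL ℝ (meanParam φ θ)) θ := by
  have h1 (y : Y) : HasStrictFDerivAt (fun θ => Real.exp (inner ℝ (φ y) θ))
      (Real.exp (inner ℝ (φ y) θ) • innerSL ℝ (φ y)) θ :=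
    (innerSL ℝ (φ y)).hasStrictFDerivAt.exp
  have h2 := (HasStrictFDerivAt.fun_sum fun y (_ : y ∈ Finset.univ) => h1 y).log (sum_exp_pos φ θ).ne'
  refine h2.congr_fderiv ?_
  ext v
  simp only [meanParam, modelDensity, logPartition, Real.exp_sub, Real.exp_log (sum_exp_pos φ θ)]
  simp [Finset.mul_sum]
  refine Finset.sum_congr rfl fun y _ => ?_
  ring

theorem dotProduct_fisherInformation_mulVec [MeasurableSpace Y] [DiscreteMeasurableSpace Y]
    (φ : Y → EuclideanSpace ℝ (Fin d)) (θ u v : EuclideanSpace ℝ (Fin d)) :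
    u ⬝ᵥ fisherInformation φ θ *ᵥ v =
      ∑ y, modelDensity φ θ y * (inner ℝ u (φ y) * inner ℝ v (φ y)) -
        inner ℝ u (meanParam φ θ) * inner ℝ v (meanParam φ θ) := by
  have hm (i : Fin d) : meanParam φ θ i = ∑ y, modelDensity φ θ y * φ y i := by
    simp [meanParam]
  have h (i j : Fin d) : fisherInformation φ θ i j =
      ∑ y, modelDensity φ θ y * (φ y i * φ y j) - meanParam φ θ i * meanParam φ θ j := by
    rw [fisherInformation, Matrix.of_apply, covariance_eq_sub .of_discrete .of_discrete]
    simp [PMF.integral_eq_sum, toReal_model, hm]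
  have hin (a b : EuclideanSpace ℝ (Fin d)) : inner ℝ a b = ∑ i, a i * b i := by
    simp [PiLp.inner_apply, mul_comm]
  simp only [dotProduct, mulVec, h, hin, sub_mul, mul_sub, Finset.sum_sub_distrib]
  congr 1
  · simp only [Finset.sum_mul_sum]
    simp only [Finset.mul_sum, Finset.sum_mul]
    rw [Finset.sum_comm_cycle]
    refine Finset.sum_congr rfl fun y _ => Finset.sum_congr rfl fun i _ =>
      Finset.sum_congr rfl fun j _ => ?_
    ring
  · rw [Finset.sum_mul_sum]
    simp only [Finset.mul_sum]
    refine Finset.sum_congr rfl fun i _ => Finset.sum_congr rfl fun j _ => ?_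
    ring

/-- The gradient of `p_θ(y)` is `p_θ(y) (φ(y) - E[φ])`, so averaging against `φ(y)` produces the
covariance. Strict differentiability is what the inverse function theorem needs. -/
theorem hasStrictFDerivAt_meanParam [MeasurableSpace Y] [DiscreteMeasurableSpace Y]
    (φ : Y → EuclideanSpace ℝ (Fin d)) (θ : EuclideanSpace ℝ (Fin d)) :
    HasStrictFDerivAt (meanParam φ) (toEuclideanCLM (𝕜 := ℝ) (fisherInformation φ θ)) θ := by
  have h1 (y : Y) : HasStrictFDerivAt (fun θ => modelDensity φ θ y)
      (modelDensity φ θ y • (innerSL ℝ (φ y) - innerSL ℝ (meanParam φ θ))) θ :=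
    ((innerSL ℝ (φ y)).hasStrictFDerivAt.sub (hasStrictFDerivAt_logPartition φ θ)).exp
  refine (HasStrictFDerivAt.fun_sum fun y (_ : y ∈ Finset.univ) =>
    (h1 y).smul_const (φ y)).congr_fderiv ?_
  ext1 v
  refine ext_inner_left ℝ fun u => ?_
  rw [inner_toEuclideanCLM, dotProduct_fisherInformation_mulVec, inner_meanParam φ θ u,
    Finset.sum_mul, ← Finset.sum_sub_distrib]
  simp only [_root_.sum_apply, inner_sum]
  refine Finset.sum_congr rfl fun y _ => ?_
  simp [inner_smul_right, real_inner_comm v]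
  ring

/-- Jensen's inequality; with the moment generating function below it becomes the gradient
inequality for the convex function `A`. -/
theorem exp_inner_meanParam_le (φ : Y → EuclideanSpace ℝ (Fin d))
    (θ v : EuclideanSpace ℝ (Fin d)) :
    Real.exp (inner ℝ v (meanParam φ θ)) ≤
      ∑ y, modelDensity φ θ y • Real.exp (inner ℝ v (φ y)) := by
  rw [inner_meanParam]
  exact convexOn_exp.map_sum_le (fun y _ => (modelDensity_pos φ θ y).le) (sum_modelDensity φ θ)
    fun _ _ => Set.mem_univ _

theorem sum_modelDensity_smul_exp (φ : Y → EuclideanSpace ℝ (Fin d))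
    (θ v : EuclideanSpace ℝ (Fin d)) :
    ∑ y, modelDensity φ θ y • Real.exp (inner ℝ v (φ y)) =
      Real.exp (logPartition φ (θ + v) - logPartition φ θ) := by
  rw [Real.exp_sub, logPartition, Real.exp_log (sum_exp_pos _ _), Finset.sum_div]
  refine Finset.sum_congr rfl fun y _ => ?_
  rw [modelDensity, inner_add_right, Real.exp_add, Real.exp_sub, real_inner_comm v, smul_eq_mul]
  ring

/-- A solution of the moment equation maximizes the moment objective. -/
theorem isMaxOn_of_meanParam_eq {φ : Y → EuclideanSpace ℝ (Fin d)}
    {μ θ : EuclideanSpace ℝ (Fin d)} (h : meanParam φ θ = μ) :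
    IsMaxOn (fun θ' => inner ℝ μ θ' - logPartition φ θ') Set.univ θ := by
  intro θ' _
  have h1 := exp_inner_meanParam_le φ θ (θ' - θ)
  rw [sum_modelDensity_smul_exp, Real.exp_le_exp, h, real_inner_comm, inner_sub_right,
    add_sub_cancel] at h1
  simp only [Set.mem_ofPred_eq]
  linarith

/-- If the Fisher information is invertible somewhere, a solution of the moment equation is the
only maximizer of the moment objective. -/
theorem eq_of_isMaxOn [MeasurableSpace Y] [DiscreteMeasurableSpace Y]
    {φ : Y → EuclideanSpace ℝ (Fin d)} {θs μ θ θ' : EuclideanSpace ℝ (Fin d)}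
    (hI : IsUnit (fisherInformation φ θs)) (h : meanParam φ θ = μ)
    (h' : IsMaxOn (fun θ' => inner ℝ μ θ' - logPartition φ θ') Set.univ θ') : θ' = θ := by
  have h1 : inner ℝ μ θ - logPartition φ θ ≤ inner ℝ μ θ' - logPartition φ θ' :=
    h' (Set.mem_univ θ)
  -- Optimality of `θ'` reverses Jensen's inequality. The equality case of strict convexity then
  -- makes `⟨θ' - θ, φ(y)⟩` constant in `y`.
  have h2 : ∑ y, modelDensity φ θ y • Real.exp (inner ℝ (θ' - θ) (φ y)) ≤
      Real.exp (∑ y, modelDensity φ θ y • inner ℝ (θ' - θ) (φ y)) := by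
    rw [sum_modelDensity_smul_exp, Real.exp_le_exp, add_sub_cancel]
    simp only [smul_eq_mul]
    rw [← inner_meanParam, h, real_inner_comm, inner_sub_right]
    linarith
  have h3 := strictConvexOn_exp.eq_of_le_map_sum (fun y _ => modelDensity_pos φ θ y)
    (sum_modelDensity φ θ) (fun _ _ => Set.mem_univ _) h2
  obtain ⟨y₀⟩ := ‹Nonempty Y›
  have h4 (y : Y) : inner ℝ (θ' - θ) (φ y) = inner ℝ (θ' - θ) (φ y₀) :=
    h3 (Finset.mem_univ _) (Finset.mem_univ _)
  -- A constant has zero covariance with everything, under `p_θs` as well.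
  have h5 : fisherInformation φ θs *ᵥ (θ' - θ).ofLp = 0 := by
    refine dotProduct_eq_zero _ fun w => ?_
    have := dotProduct_fisherInformation_mulVec φ θs (WithLp.toLp 2 w) (θ' - θ)
    rw [dotProduct_comm]
    refine this.trans ?_
    simp only [inner_meanParam, h4, ← mul_assoc, ← Finset.sum_mul, sum_modelDensity]
    simp
  have h6 : (θ' - θ).ofLp = 0 :=
    (Matrix.mulVec_injective_of_isUnit hI) (by rw [h5, mulVec_zero])
  exact sub_eq_zero.1 (WithLp.ofLp_injective 2 h6)

end ExponentialFamily

/-! ### The central limit theorem and the delta method. -/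

section Limits

variable {Ω Ω' E F : Type*} [MeasurableSpace Ω] [MeasurableSpace Ω'] {P : Measure Ω}
  {P' : Measure Ω'}

/-- The Cramér–Wold device: it reduces the multivariate limit to real projections. -/
theorem charFun_map_eq_charFun_inner [NormedAddCommGroup E] [InnerProductSpace ℝ E]
    [MeasurableSpace E] [BorelSpace E] {X : Ω → E} (hX : AEMeasurable X P)
    [SecondCountableTopology E] (t : E) :
    charFun (P.map X) t = charFun (P.map fun ω => inner ℝ t (X ω)) 1 := by
  have h : AEMeasurable (fun ω => inner ℝ t (X ω)) P := by fun_prop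
  rw [charFun_apply, charFun_apply, integral_map hX (by fun_prop), integral_map h (by fun_prop)]
  simp [real_inner_comm t]

variable [IsProbabilityMeasure P] [IsProbabilityMeasure P']

/-- The multivariate central limit theorem. -/
theorem tendstoInDistribution_sqrt_smul_average_sub [NormedAddCommGroup E] [InnerProductSpace ℝ E]
    [FiniteDimensional ℝ E] [MeasurableSpace E] [BorelSpace E] {X : ℕ → Ω → E} {Z : Ω' → E}
    (hZ : AEMeasurable Z P')
    (hZX : ∀ t, charFun (P'.map Z) t =
      Complex.exp (-(Var[fun ω => inner ℝ t (X 0 ω); P] : ℂ) / 2))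
    (hX : MemLp (X 0) 2 P) (hindep : iIndepFun X P)
    (hident : ∀ i, IdentDistrib (X i) (X 0) P P) :
    TendstoInDistribution
      (fun (n : ℕ) ω => √(n : ℝ) • ((n : ℝ)⁻¹ • ∑ i ∈ Finset.range n, X i ω - P[X 0])) atTop Z
      (fun _ => P) P' := by
  have hm (i : ℕ) : AEMeasurable (X i) P := (hident i).aemeasurable_fst
  have hmeas (n : ℕ) : AEMeasurable
      (fun ω => √(n : ℝ) • ((n : ℝ)⁻¹ • ∑ i ∈ Finset.range n, X i ω - P[X 0])) P := by
    have := Finset.aemeasurable_fun_sum (Finset.range n) fun i _ => hm i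
    fun_prop
  refine ⟨hmeas, hZ, ProbabilityMeasure.tendsto_iff_tendsto_charFun.2 fun t => ?_⟩
  have hclt := tendstoInDistribution_inv_sqrt_mul_sum_sub (P := P)
    (X := fun i ω => inner ℝ t (X i ω)) (HasLaw.id (μ := gaussianReal 0 _))
    (hX.const_inner t) (hindep.comp (fun _ x => inner ℝ t x) (by fun_prop))
    (fun i => (hident i).comp (u := fun x => inner ℝ t x) (by fun_prop))
  have := ProbabilityMeasure.tendsto_iff_tendsto_charFun.1 hclt.tendsto 1
  simp only [ProbabilityMeasure.coe_mk, Measure.map_id, charFun_gaussianReal] at this ⊢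
  rw [hZX]
  convert this using 2 with n
  · rw [charFun_map_eq_charFun_inner (hmeas n)]
    congr 2
    ext ω
    rcases Nat.eq_zero_or_pos n with rfl | hn
    · simp
    have hn' : √(n : ℝ) ≠ 0 := by positivity
    have hs : √(n : ℝ) * √(n : ℝ) = n := Real.mul_self_sqrt (by positivity)
    rw [inner_smul_right, inner_sub_right, inner_smul_right, inner_sum,
      integral_inner (hX.integrable (by norm_num))]
    generalize √(n : ℝ) = s at hn' hs
    rw [← hs]
    field_simp
  · simp [Real.coe_toNNReal _ (variance_nonneg _ _), neg_div]

/-- The delta method, for a sequence `T` that agrees eventually almost surely with the image of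
`X` under a function `ψ` that is differentiable at the limit of `X`. -/
theorem tendstoInDistribution_delta [NormedAddCommGroup E] [NormedSpace ℝ E] [MeasurableSpace E]
    [BorelSpace E] [SecondCountableTopology E] [NormedAddCommGroup F] [NormedSpace ℝ F]
    [MeasurableSpace F] [BorelSpace F] [SecondCountableTopology F] {X : ℕ → Ω → E}
    {T : ℕ → Ω → F} {Z : Ω' → E} {m : E} {ψ : E → F} {L : E →L[ℝ] F} {r : ℕ → ℝ}
    (hψ : HasFDerivAt ψ L m) (hX : ∀ n, AEMeasurable (X n) P) (hT : ∀ n, AEMeasurable (T n) P)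
    (hZ : TendstoInDistribution (fun n ω => r n • (X n ω - m)) atTop Z (fun _ => P) P')
    (hr : ∀ n, 0 ≤ r n)
    (hlim : ∀ᵐ ω ∂P, Tendsto (fun n => X n ω) atTop (𝓝 m))
    (hTX : ∀ᵐ ω ∂P, ∀ᶠ n in atTop, T n ω = ψ (X n ω)) :
    TendstoInDistribution (fun n ω => r n • (T n ω - ψ m)) atTop (fun ω => L (Z ω))
      (fun _ => P) P' := by
  -- `w` is the normalized first-order remainder and `e` is an error that vanishes once `T n = ψ (X
  -- n)`. Using `T n` instead of `ψ (X n)` keeps both measurable, although `ψ` need not be.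
  set w : ℕ → Ω → F := fun n ω => ‖X n ω - m‖⁻¹ • (T n ω - ψ m - L (X n ω - m)) with hw
  set e : ℕ → Ω → F := fun n ω =>
    r n • (T n ω - ψ m) - (L (r n • (X n ω - m)) + ‖r n • (X n ω - m)‖ • w n ω) with he
  have hwm (n : ℕ) : AEMeasurable (w n) P := by
    have h1 := hX n
    have h2 := hT n
    fun_prop
  have hem (n : ℕ) : AEMeasurable (e n) P := by
    have h1 := hX n
    have h2 := hT n
    have h3 := hwm n
    fun_prop
  have hwlim : ∀ᵐ ω ∂P, Tendsto (fun n => w n ω) atTop (𝓝 0) := by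
    filter_upwards [hlim, hTX] with ω h1 h2
    have h3 := (hasFDerivAt_iff_tendsto.1 hψ).comp h1
    rw [tendsto_zero_iff_norm_tendsto_zero]
    refine h3.congr' ?_
    filter_upwards [h2] with n hn
    simp [hw, hn, norm_smul]
  have helim : ∀ᵐ ω ∂P, Tendsto (fun n => e n ω) atTop (𝓝 0) := by
    filter_upwards [hTX] with ω h2
    refine tendsto_const_nhds.congr' ?_
    filter_upwards [h2] with n hn
    by_cases h0 : X n ω = m
    · simp [he, hn, h0]
    · have h0' : ‖X n ω - m‖ ≠ 0 := norm_ne_zero_iff.2 (sub_ne_zero.2 h0)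
      simp only [he, hw, norm_smul, Real.norm_of_nonneg (hr n), smul_smul, map_smul]
      rw [mul_assoc, mul_inv_cancel₀ h0', mul_one, ← smul_add]
      simp
  have hpair := tendstoInMeasure_of_tendsto_ae (μ := P) (f := fun n ω => (w n ω, e n ω))
    (g := fun _ => ((0 : F), (0 : F))) (fun n => ((hwm n).prodMk (hem n)).aestronglyMeasurable)
    (by filter_upwards [hwlim, helim] with ω h1 h2 using h1.prodMk_nhds h2)
  -- Slutsky's theorem: `w` and `e` tend to 0 in probability, so only `L` survives in the limit.
  have := hZ.continuous_comp_prodMk_of_tendstoInMeasure_const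
    (g := fun x : E × F × F => L x.1 + ‖x.1‖ • x.2.1 + x.2.2) (by fun_prop) hpair
    (fun n => (hwm n).prodMk (hem n))
  simpa [he] using this

end Limits

theorem toEuclideanCLM_nonsing_inv_apply {ι : Type*} [Fintype ι] [DecidableEq ι]
    {A : Matrix ι ι ℝ} (hA : IsUnit A.det) (x : EuclideanSpace ℝ ι) :
    toEuclideanCLM (𝕜 := ℝ) A⁻¹ (toEuclideanCLM (𝕜 := ℝ) A x) = x := by
  rw [← ContinuousLinearMap.comp_apply, ← ContinuousLinearMap.mul_def, ← map_mul,
    Matrix.nonsing_inv_mul _ hA, map_one]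
  rfl

theorem toEuclideanCLM_apply_nonsing_inv {ι : Type*} [Fintype ι] [DecidableEq ι]
    {A : Matrix ι ι ℝ} (hA : IsUnit A.det) (x : EuclideanSpace ℝ ι) :
    toEuclideanCLM (𝕜 := ℝ) A (toEuclideanCLM (𝕜 := ℝ) A⁻¹ x) = x := by
  rw [← ContinuousLinearMap.comp_apply, ← ContinuousLinearMap.mul_def, ← map_mul,
    Matrix.mul_nonsing_inv _ hA, map_one]
  rfl

/-! ### The moment estimate near the true mean, and the covariance of the observations. -/

section Estimation

variable {Y : Type*} [MeasurableSpace Y] {d : ℕ}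

theorem coordinateReleaseLoss_transpose (φ : Y → EuclideanSpace ℝ (Fin d)) (π : PMF Y) (α : ℝ) :
    (coordinateReleaseLoss φ π α)ᵀ = coordinateReleaseLoss φ π α := by
  rw [coordinateReleaseLoss, Matrix.transpose_add, Matrix.transpose_smul, Matrix.transpose_one]
  congr 1
  ext i j
  rw [Matrix.transpose_apply, Matrix.of_apply, Matrix.of_apply]
  congr 1
  ext y
  have h : ((d : ℝ) • (Matrix.diagonal fun k => φ y k) ^ 2 -
      Matrix.vecMulVec (fun k => φ y k) (fun k => φ y k))ᵀ = (d : ℝ) •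
        (Matrix.diagonal fun k => φ y k) ^ 2 -
          Matrix.vecMulVec (fun k => φ y k) (fun k => φ y k) := by
    simp [Matrix.diagonal_pow, Matrix.transpose_vecMulVec]
  exact congrFun (congrFun h i) j

variable [Fintype Y] [Nonempty Y]

theorem fisherInformation_transpose (φ : Y → EuclideanSpace ℝ (Fin d))
    (θ : EuclideanSpace ℝ (Fin d)) : (fisherInformation φ θ)ᵀ = fisherInformation φ θ := by
  ext i j
  exact covariance_comm _ _

variable [DiscreteMeasurableSpace Y]

/-- Near the true mean, the moment-based estimator is a differentiable function of the empirical
mean, with derivative the inverse Fisher information. -/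
theorem exists_hasFDerivAt_momentEstimate {φ : Y → EuclideanSpace ℝ (Fin d)}
    {θ : EuclideanSpace ℝ (Fin d)} (hI : IsUnit (fisherInformation φ θ)) :
    ∃ ψ : EuclideanSpace ℝ (Fin d) → EuclideanSpace ℝ (Fin d),
      HasFDerivAt ψ (toEuclideanCLM (𝕜 := ℝ) (fisherInformation φ θ)⁻¹) (meanParam φ θ) ∧
      ψ (meanParam φ θ) = θ ∧
      ∀ᶠ μ in 𝓝 (meanParam φ θ), ∀ θhat, IsMomentEstimate φ μ θhat → θhat = ψ μ := by
  have hdet : IsUnit (fisherInformation φ θ).det := (Matrix.isUnit_iff_isUnit_det _).1 hI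
  have hF : HasStrictFDerivAt (meanParam φ)
      ((ContinuousLinearEquiv.equivOfInverse _ _ (toEuclideanCLM_nonsing_inv_apply hdet)
        (toEuclideanCLM_apply_nonsing_inv hdet) :
        EuclideanSpace ℝ (Fin d) ≃L[ℝ] EuclideanSpace ℝ (Fin d)) :
        EuclideanSpace ℝ (Fin d) →L[ℝ] EuclideanSpace ℝ (Fin d)) θ :=
    hasStrictFDerivAt_meanParam φ θ
  refine ⟨hF.localInverse, hF.to_localInverse.hasFDerivAt, hF.localInverse_apply_image, ?_⟩
  -- The local inverse solves the moment equation, so a maximizer exists, the estimate must be one,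
  -- and uniqueness identifies the two.
  filter_upwards [hF.eventually_right_inverse] with μ hμ θhat hθ
  exact eq_of_isMaxOn hI hμ (hθ ⟨_, isMaxOn_of_meanParam_eq hμ⟩)

/-- Each summand is the conditional variance of `⟨u, β(o)⟩` given `y`, which exhibits `H` as the
mean conditional covariance. -/
theorem dotProduct_coordinateReleaseLoss_mulVec (φ : Y → EuclideanSpace ℝ (Fin d))
    (θ u : EuclideanSpace ℝ (Fin d)) (α : ℝ) :
    u ⬝ᵥ coordinateReleaseLoss φ (model φ θ) α *ᵥ u =
      ∑ y, modelDensity φ θ y * (∑ j, d * (φ y j ^ 2 +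
        keepProb α * (1 - keepProb α) / (2 * keepProb α - 1) ^ 2) * u j ^ 2 -
          inner ℝ u (φ y) ^ 2) := by
  have h : coordinateReleaseLoss φ (model φ θ) α =
      ∑ y, modelDensity φ θ y • ((d * keepProb α * (1 - keepProb α) / (2 * keepProb α - 1) ^ 2) •
        (1 : Matrix (Fin d) (Fin d) ℝ) + ((d : ℝ) • (Matrix.diagonal fun k => φ y k) ^ 2 -
          Matrix.vecMulVec (fun k => φ y k) (fun k => φ y k))) := by
    simp only [smul_add, Finset.sum_add_distrib, ← Finset.sum_smul, sum_modelDensity, one_smul,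
      coordinateReleaseLoss]
    congr 1
    ext i j
    rw [Matrix.of_apply, PMF.integral_eq_sum, Matrix.sum_apply]
    simp only [toReal_model, Matrix.smul_apply]
  have hin (y : Y) : inner ℝ u (φ y) = u.ofLp ⬝ᵥ (φ y).ofLp := by
    simp [PiLp.inner_apply, dotProduct, mul_comm]
  rw [h, Matrix.sum_mulVec, dotProduct_sum]
  refine Finset.sum_congr rfl fun y _ => ?_
  rw [Matrix.smul_mulVec, dotProduct_smul, smul_eq_mul, Matrix.add_mulVec, Matrix.sub_mulVec,
    dotProduct_add, dotProduct_sub, Matrix.diagonal_pow, Matrix.smul_mulVec, Matrix.smul_mulVec,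
    dotProduct_smul, dotProduct_smul, Matrix.one_mulVec, Matrix.vecMulVec_mulVec, hin, sq (_ ⬝ᵥ _),
    ← add_sub_assoc]
  congr 2
  · simp only [dotProduct, Matrix.mulVec_diagonal, smul_eq_mul, Finset.mul_sum,
      ← Finset.sum_add_distrib]
    refine Finset.sum_congr rfl fun j _ => ?_
    simp
    ring
  · simp [dotProduct_comm u.ofLp]

/-- The moments of the observation function under the joint law of labels and releases. -/
theorem integral_jointLaw_coordinateReleaseObs [NeZero d] {φ : Y → EuclideanSpace ℝ (Fin d)}
    (hφ : ∀ y i, φ y i = 0 ∨ φ y i = 1) {α : ℝ} (hα : 0 < α) (θ u : EuclideanSpace ℝ (Fin d)) :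
    ∫ x, inner ℝ u (coordinateReleaseObs (PMF.uniformOfFintype (Fin d)) α 1 x.2)
      ∂(jointLaw (model φ θ) fun y =>
        coordinateRelease (PMF.uniformOfFintype (Fin d)) α 1 (φ y)).toMeasure =
      inner ℝ u (meanParam φ θ) := by
  rw [integral_jointLaw _ _ fun o => inner ℝ u (coordinateReleaseObs _ α 1 o), inner_meanParam]
  simp only [toReal_model, integral_inner_coordinateReleaseObs hα (hφ _)]

theorem variance_jointLaw_coordinateReleaseObs [NeZero d] {φ : Y → EuclideanSpace ℝ (Fin d)}
    (hφ : ∀ y i, φ y i = 0 ∨ φ y i = 1) {α : ℝ} (hα : 0 < α) (θ u : EuclideanSpace ℝ (Fin d)) :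
    Var[fun x => inner ℝ u (coordinateReleaseObs (PMF.uniformOfFintype (Fin d)) α 1 x.2);
      (jointLaw (model φ θ) fun y =>
        coordinateRelease (PMF.uniformOfFintype (Fin d)) α 1 (φ y)).toMeasure] =
      u ⬝ᵥ (fisherInformation φ θ + coordinateReleaseLoss φ (model φ θ) α) *ᵥ u := by
  rw [variance_eq_sub .of_discrete, integral_jointLaw_coordinateReleaseObs hφ hα]
  simp only [Pi.pow_apply]
  rw [integral_jointLaw _ _ fun o => inner ℝ u (coordinateReleaseObs _ α 1 o) ^ 2,
    Matrix.add_mulVec, dotProduct_add, dotProduct_fisherInformation_mulVec,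
    dotProduct_coordinateReleaseLoss_mulVec]
  simp only [toReal_model, integral_sq_inner_coordinateReleaseObs hα (hφ _), mul_sub,
    Finset.sum_sub_distrib, ← sq]
  abel

theorem posSemidef_fisherInformation_add_coordinateReleaseLoss [NeZero d]
    {φ : Y → EuclideanSpace ℝ (Fin d)} (hφ : ∀ y i, φ y i = 0 ∨ φ y i = 1) {α : ℝ} (hα : 0 < α)
    (θ : EuclideanSpace ℝ (Fin d)) :
    (fisherInformation φ θ + coordinateReleaseLoss φ (model φ θ) α).PosSemidef := by
  refine .of_dotProduct_mulVec_nonneg ?_ fun x => ?_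
  · rw [Matrix.IsHermitian, Matrix.conjTranspose_eq_transpose_of_trivial, Matrix.transpose_add,
      fisherInformation_transpose, coordinateReleaseLoss_transpose]
  · have := variance_jointLaw_coordinateReleaseObs hφ hα θ (WithLp.toLp 2 x)
    rw [star_trivial]
    exact this ▸ variance_nonneg _ _

end Estimation

/-! ### Asymptotic normality for general unbiased observations. -/

theorem charFun_map_multivariateGaussian {ι : Type*} [Fintype ι] [DecidableEq ι]
    {V : Matrix ι ι ℝ} (hV : V.PosSemidef) (A : Matrix ι ι ℝ) (t : EuclideanSpace ℝ ι) :
    charFun ((multivariateGaussian 0 V).map (toEuclideanCLM (𝕜 := ℝ) A)) t =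
      Complex.exp (-((t ⬝ᵥ (A * V * Aᵀ) *ᵥ t : ℝ) : ℂ) / 2) := by
  have h : charFun ((multivariateGaussian 0 V).map (toEuclideanCLM (𝕜 := ℝ) A)) t =
      charFun (multivariateGaussian 0 V) (toEuclideanCLM (𝕜 := ℝ) Aᵀ t) := by
    rw [charFun_apply, charFun_apply, integral_map (by fun_prop) (by fun_prop)]
    congr with x
    rw [real_inner_comm, inner_toEuclideanCLM, inner_toEuclideanCLM, Matrix.mulVec_transpose,
      dotProduct_mulVec, dotProduct_comm]
  rw [h, charFun_multivariateGaussian hV]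
  have : (toEuclideanCLM (𝕜 := ℝ) Aᵀ t).ofLp = Aᵀ *ᵥ t.ofLp := rfl
  rw [this, ← Matrix.mulVec_mulVec, ← Matrix.mulVec_mulVec, dotProduct_mulVec t.ofLp A,
    ← Matrix.mulVec_transpose]
  simp [neg_div]

/-- A moment-based estimator computed from i.i.d. square integrable unbiased observations of the
mean parameter, with covariance `S`, has asymptotic variance `I⁻¹ * S * I⁻¹`, where `I` is the Fisher
information. -/
theorem hasAsymptoticVariance_momentEstimate {Y Ω : Type*} [Fintype Y] [Nonempty Y]
    [MeasurableSpace Y] [DiscreteMeasurableSpace Y] [MeasurableSpace Ω] {P : Measure Ω}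
    [IsProbabilityMeasure P] {d : ℕ} {φ : Y → EuclideanSpace ℝ (Fin d)}
    {θ : EuclideanSpace ℝ (Fin d)} (hI : IsUnit (fisherInformation φ θ))
    {S : Matrix (Fin d) (Fin d) ℝ} (hS : S.PosSemidef) {X : ℕ → Ω → EuclideanSpace ℝ (Fin d)}
    (hX : MemLp (X 0) 2 P) (hindep : iIndepFun X P)
    (hident : ∀ i, IdentDistrib (X i) (X 0) P P) (hmean : P[X 0] = meanParam φ θ)
    (hvar : ∀ t, Var[fun ω => inner ℝ t (X 0 ω); P] = t ⬝ᵥ S *ᵥ t)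
    {θhat : ℕ → Ω → EuclideanSpace ℝ (Fin d)} (hmeas : ∀ n, AEMeasurable (θhat n) P)
    (hest : ∀ n : ℕ, ∀ᵐ ω ∂P,
      IsMomentEstimate φ ((n : ℝ)⁻¹ • ∑ i ∈ Finset.range n, X i ω) (θhat n ω)) :
    HasAsymptoticVariance P θhat θ ((fisherInformation φ θ)⁻¹ * S * (fisherInformation φ θ)⁻¹) := by
  have hdet := (Matrix.isUnit_iff_isUnit_det _).1 hI
  have hIt := fisherInformation_transpose φ θ
  obtain ⟨ψ, hψ, hψm, hψest⟩ := exists_hasFDerivAt_momentEstimate hI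
  generalize fisherInformation φ θ = J at hdet hIt hψ
  have hV : (J⁻¹ * S * J⁻¹).PosSemidef := by
    have := hS.mul_mul_conjTranspose_same J⁻¹
    rwa [Matrix.conjTranspose_eq_transpose_of_trivial, Matrix.transpose_nonsing_inv, hIt] at this
  have hJV : J * (J⁻¹ * S * J⁻¹) * Jᵀ = S := by
    rw [hIt, Matrix.mul_assoc J⁻¹, ← Matrix.mul_assoc J, Matrix.mul_nonsing_inv _ hdet,
      Matrix.one_mul, Matrix.mul_assoc, Matrix.nonsing_inv_mul _ hdet, Matrix.mul_one]
  -- The limit `N(0, S)` is realized as `J Z` with `Z ∼ N(0, J⁻¹ S J⁻¹)`, so that the `J⁻¹` of the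
  -- delta method returns exactly `Z`.
  have hclt := tendstoInDistribution_sqrt_smul_average_sub
    (P' := multivariateGaussian 0 (J⁻¹ * S * J⁻¹)) (Z := toEuclideanCLM (𝕜 := ℝ) J) (by fun_prop)
    (fun t => by rw [charFun_map_multivariateGaussian hV, hJV, hvar]) hX hindep hident
  have hlln := strong_law_ae X (hX.integrable (by norm_num))
    (fun i j hij => hindep.indepFun hij) hident
  rw [hmean] at hclt hlln
  have hdelta := tendstoInDistribution_delta hψ
    (fun n => (Finset.aemeasurable_fun_sum (Finset.range n) fun i _ =>
      (hident i).aemeasurable_fst).const_smul (n : ℝ)⁻¹) hmeas hclt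
    (fun n => Real.sqrt_nonneg _) hlln
    (by
      filter_upwards [hlln, ae_all_iff.2 hest] with ω h1 h2
      filter_upwards [h1.eventually hψest] with n hn using hn _ (h2 n))
  simp only [hψm, toEuclideanCLM_nonsing_inv_apply hdet] at hdelta
  exact ⟨hV, hdelta⟩

end IndirectSupervision

/-! ### The theorem for coordinate release. -/

theorem mainTheorem4 {Y : Type*} [Fintype Y] [Nonempty Y] [MeasurableSpace Y]
    [DiscreteMeasurableSpace Y] {d : ℕ} [NeZero d]
    (φ : Y → EuclideanSpace ℝ (Fin d)) (hφ : ∀ y i, φ y i = 0 ∨ φ y i = 1)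
    (α : ℝ) (hα : 0 < α)
    (θstar : EuclideanSpace ℝ (Fin d))
    (hI : IsUnit (IndirectSupervision.fisherInformation φ θstar)) :
    IndirectSupervision.IsDifferentiallyPrivate
      (fun y => IndirectSupervision.coordinateRelease (PMF.uniformOfFintype (Fin d)) α 1 (φ y)) α ∧
    ∀ {Ω : Type*} [MeasurableSpace Ω] (P : Measure Ω) [IsProbabilityMeasure P]
      (y : ℕ → Ω → Y) (o : ℕ → Ω → Fin d × Bool)
      (_hindep : iIndepFun (fun i ω => (y i ω, o i ω)) P)
      (_hlaw : ∀ i, HasLaw (fun ω => (y i ω, o i ω))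
        (IndirectSupervision.jointLaw (IndirectSupervision.model φ θstar) fun y' =>
          IndirectSupervision.coordinateRelease
            (PMF.uniformOfFintype (Fin d)) α 1 (φ y')).toMeasure P)
      (θhat : ℕ → Ω → EuclideanSpace ℝ (Fin d))
      (_hmeas : ∀ n, AEMeasurable (θhat n) P)
      (_hest : ∀ n, ∀ᵐ ω ∂P, IndirectSupervision.IsMomentEstimate φ
        (IndirectSupervision.empiricalMoment
          (IndirectSupervision.coordinateReleaseObs (PMF.uniformOfFintype (Fin d)) α 1) n
          (fun i => o i ω))
        (θhat n ω)),
      IndirectSupervision.HasAsymptoticVariance P θhat θstar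
        ((IndirectSupervision.fisherInformation φ θstar)⁻¹ +
          (IndirectSupervision.fisherInformation φ θstar)⁻¹ *
            IndirectSupervision.coordinateReleaseLoss φ
              (IndirectSupervision.model φ θstar) α *
            (IndirectSupervision.fisherInformation φ θstar)⁻¹) := by
  refine ⟨IndirectSupervision.isDifferentiallyPrivate_coordinateRelease _ hφ hα, ?_⟩
  intro Ω _ P _ y o hindep hlaw θhat hmeas hest
  have hdet := (Matrix.isUnit_iff_isUnit_det _).1 hI
  have hV (J H : Matrix (Fin d) (Fin d) ℝ) (hJ : IsUnit J.det) :
      J⁻¹ + J⁻¹ * H * J⁻¹ = J⁻¹ * (J + H) * J⁻¹ := by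
    rw [Matrix.mul_add, Matrix.nonsing_inv_mul _ hJ, Matrix.add_mul, Matrix.one_mul]
  rw [hV _ _ hdet]
  let β := IndirectSupervision.coordinateReleaseObs (PMF.uniformOfFintype (Fin d)) α 1
  have hβ : Measurable fun x : Y × (Fin d × Bool) => β x.2 := .of_discrete
  -- `β` takes finitely many values, hence is bounded.
  have hX : MemLp (fun ω => β (o 0 ω)) 2 P := by
    refine MemLp.of_bound (hβ.comp_aemeasurable (hlaw 0).aemeasurable).aestronglyMeasurable
      (∑ x, ‖β x‖) (.of_forall fun ω => ?_)
    exact Finset.single_le_sum (f := fun x => ‖β x‖) (fun _ _ => norm_nonneg _) (Finset.mem_univ _)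
  refine IndirectSupervision.hasAsymptoticVariance_momentEstimate hI
    (IndirectSupervision.posSemidef_fisherInformation_add_coordinateReleaseLoss hφ hα θstar)
    hX (hindep.comp (fun _ (x : Y × (Fin d × Bool)) => β x.2) fun _ => hβ) (fun i => ?_) ?_
    (fun t => ?_) hmeas hest
  · exact IdentDistrib.comp (u := fun x : Y × (Fin d × Bool) => β x.2)
      ⟨(hlaw i).aemeasurable, (hlaw 0).aemeasurable, (hlaw i).map_eq.trans (hlaw 0).map_eq.symm⟩ hβ
  · refine ext_inner_left ℝ fun u => ?_
    change inner ℝ u (∫ ω, β (o 0 ω) ∂P) = _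
    rw [← integral_inner (hX.integrable (by norm_num)),
      ← IndirectSupervision.integral_jointLaw_coordinateReleaseObs hφ hα θstar u]
    exact (hlaw 0).integral_comp (f := fun x => inner ℝ u (β x.2))
      Measurable.of_discrete.aestronglyMeasurable
  · rw [← IndirectSupervision.variance_jointLaw_coordinateReleaseObs hφ hα θstar t,
      ← (hlaw 0).map_eq, variance_map Measurable.of_discrete.aemeasurable (hlaw 0).aemeasurable]
    rfl
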